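/- Let $k$ be a commutative ring, and for $n\ge 1$ let $\mathcal A_n=kS_n$ be the free $k$-module with basis $F_\sigma$, $\sigma\in S_n$ (permutations are written as words $\sigma=(\sigma_1,\dots,\sigma_n)$). The non-symmetric associative operad $\mathcal A=\{\mathcal A_n\}_{n\ge1}$ has unit $F_{(1)}\in\mathcal A_1$ and the bilinear structure maps $$\circ_i:\mathcal A_n\otimes\mathcal A_m\to\mathcal A_{n+m-1},\qquad F_\sigma\circ_iF_\tau=F_{B_i(\sigma,\tau)}\qquad(n,m\ge1,\ 1\le i\le n),$$ where $B_i(\sigma,\tau)=(a_1,\dots,a_{i-1},b_1,\dots,b_m,a_{i+1},\dots,a_n)$ with $a_j=\sigma_j$ if $\sigma_j<\sigma_i$, $a_j=\sigma_j+m-1$ if $\sigma_j>\sigma_i$, and $b_l=\tau_l+\sigma_i-1$. Let $\mathcal A_*=\bigoplus_{n\ge1}kS_n$ with the (non-counital) coproduct $$\Delta(F_\sigma)=\sum_{i=1}^{n-1}F_{\mathrm{st}(\sigma_1,\dots,\sigma_i)}\otimes F_{\mathrm{st}(\sigma_{i+1},\dots,\sigma_n)}\qquad(\sigma\in S_n),$$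 where the standardization $\mathrm{st}(a)$ of a sequence $a$ of $r$ distinct integers is the unique permutation of $\{1,\dots,r\}$ with $\mathrm{st}(a)_p<\mathrm{st}(a)_q\iff a_p<a_q$. Let $\mathcal Q_*=\bigoplus_{n\ge1}kQ_n$ (quasi-symmetric functions of positive degree), where $kQ_n$ is the free $k$-module with basis $F_{\mathsf S}$, $\mathsf S\subseteq\{1,\dots,n-1\}$, and let $D:\mathcal A_*\to\mathcal Q_*$ be the linear descent map $D(F_\sigma)=F_{\mathrm{Des}(\sigma)}$, with $\mathrm{Des}(\sigma)=\{p:\sigma_p>\sigma_{p+1}\}$. The Hopf kernel of $D$ is $$\mathcal K_*=\ker(D)\cap\ker\bigl((\mathrm{id}\otimes D)\circ\Delta\bigr)\subseteq\mathcal A_*,$$ and $\mathcal K_n=\mathcal K_*\cap kS_n$ is its component of degree $n$. Then $\mathcal K=\{\mathcal K_n\}_{n\ge1}$ is a non-symmetric suboperad of $\mathcal A$, in the sense that it is closed under all structure maps (it is not required to contain the unit): for all $n,m\ge1$, all $1\le i\le n$, all $x\in\mathcal K_n$ and all $y\in\mathcal K_m$, $$x\circ_iy\in\mathcal K_{n+m-1}.$$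 -/

import Mathlib

open scoped TensorProduct DirectSum

/-!  Conventions.  All families are indexed by `n : ℕ`, and the index `n` stands for arity
(= degree) `n + 1`; thus the arities that occur are exactly `1, 2, 3, …`, and the partial
composition of arities `n + 1` and `m + 1` lands in arity `(n + 1) + (m + 1) - 1 = (n + m) + 1`.
Letters, positions and values are numbered from `0`: the interval `[n + 1]` is `Fin (n + 1)`. -/

/-- A non-symmetric unital operad structure (partial compositions) on a sequence of `k`-modules;
`P n` is the component of arity `n + 1`.  The laws compare elements of components whose arities
are equal but not syntactically so, whence `HEq`. -/
structure NSOperad (k : Type*) [CommRing k] (P : ℕ → Type*)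
    [∀ n, AddCommGroup (P n)] [∀ n, Module k (P n)] where
  /-- `comp i x y` is `x ∘ᵢ y`. -/
  comp : ∀ {n m : ℕ}, Fin (n + 1) → (P n →ₗ[k] P m →ₗ[k] P (n + m))
  /-- the unit, of arity one -/
  one : P 0
  assoc_parallel : ∀ {n m l : ℕ} (i j : Fin (n + 1)), i < j →
    ∀ (x : P n) (y : P m) (z : P l),
      HEq (comp (⟨j + m, by omega⟩ : Fin (n + m + 1)) (comp i x y) z)
        (comp (⟨i, by omega⟩ : Fin (n + l + 1)) (comp j x z) y)
  assoc_nested : ∀ {n m l : ℕ} (i : Fin (n + 1)) (j : Fin (m + 1))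
    (x : P n) (y : P m) (z : P l),
      HEq (comp (⟨i + j, by omega⟩ : Fin (n + m + 1)) (comp i x y) z)
        (comp i x (comp j y z))
  comp_one : ∀ {n : ℕ} (i : Fin (n + 1)) (x : P n), comp i x one = x
  one_comp : ∀ {n : ℕ} (x : P n), HEq (comp 0 one x) x

/-- A sequence of submodules is a (not necessarily unital) non-symmetric suboperad if it is
closed under all the partial compositions `∘ᵢ`. -/
def NSOperad.IsSuboperad {k : Type*} [CommRing k] {P : ℕ → Type*}
    [∀ n, AddCommGroup (P n)] [∀ n, Module k (P n)]
    (O : NSOperad k P) (K : ∀ n, Submodule k (P n)) : Prop :=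
  ∀ (n m : ℕ) (i : Fin (n + 1)), ∀ x ∈ K n, ∀ y ∈ K m, O.comp i x y ∈ K (n + m)

/-! ### The non-symmetric associative operad -/

/-- The module `k S_{n+1}`, with basis `F_σ = Finsupp.single σ 1`. -/
abbrev AsMod (k : Type*) [CommRing k] (n : ℕ) : Type _ := Equiv.Perm (Fin (n + 1)) →₀ k

/-- The one-line notation `(a₁, …, a_{i-1}, b₁, …, b_m, a_{i+1}, …, a_n)` of `Bᵢ(σ, τ)`:
the letter of `σ` at position `i` is replaced by a translate of the word `τ`, and the letters of
`σ` that exceed `σ i` are raised accordingly. -/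
def insertFun {n m : ℕ} (i : Fin (n + 1)) (σ : Equiv.Perm (Fin (n + 1)))
    (τ : Equiv.Perm (Fin (m + 1))) (p : Fin (n + m + 1)) : Fin (n + m + 1) :=
  let a : Fin (n + 1) → Fin (n + m + 1) := fun j =>
    if σ j < σ i then ⟨σ j, by omega⟩ else ⟨σ j + m, by omega⟩
  let b : Fin (m + 1) → Fin (n + m + 1) := fun j => ⟨σ i + τ j, by omega⟩
  if h₁ : (p : ℕ) < i then a ⟨p, by omega⟩
  else if h₂ : (p : ℕ) ≤ i + m then b ⟨p - i, by omega⟩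
  else a ⟨p - m, by omega⟩

/-- Values of a permutation as a function on `ℕ` (extended by `0`). -/
def permNat {n : ℕ} (σ : Equiv.Perm (Fin (n + 1))) (p : ℕ) : ℕ :=
  if h : p < n + 1 then (σ ⟨p, h⟩ : ℕ) else 0

theorem permNat_coe {n : ℕ} (σ : Equiv.Perm (Fin (n + 1))) (p : Fin (n + 1)) :
    permNat σ p = σ p := by
  simp only [permNat, p.2, dif_pos, Fin.eta]

theorem permNat_lt {n : ℕ} (σ : Equiv.Perm (Fin (n + 1))) (p : ℕ) : permNat σ p < n + 1 := by
  unfold permNat; split <;> omega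

theorem permNat_inj {n : ℕ} (σ : Equiv.Perm (Fin (n + 1))) (p q : ℕ) (hp : p < n + 1)
    (hq : q < n + 1) (h : permNat σ p = permNat σ q) : p = q := by
  simp only [permNat, hp, hq, dif_pos] at h
  have := σ.injective (Fin.ext h)
  simpa using this

/-- The formula for the values of `Bᵢ(σ, τ)`, on functions on `ℕ`. -/
def insertNat (i m : ℕ) (s t : ℕ → ℕ) (p : ℕ) : ℕ :=
  if p < i then (if s p < s i then s p else s p + m)
  else if p ≤ i + m then s i + t (p - i)
  else (if s (p - m) < s i then s (p - m) else s (p - m) + m)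

theorem insertFun_val {n m : ℕ} (i : Fin (n + 1)) (σ : Equiv.Perm (Fin (n + 1)))
    (τ : Equiv.Perm (Fin (m + 1))) (p : Fin (n + m + 1)) :
    (insertFun i σ τ p : ℕ) = insertNat i m (permNat σ) (permNat τ) p := by
  have hp := p.2
  have hi := i.2
  unfold insertFun insertNat
  rw [permNat_coe σ i]
  dsimp only
  by_cases h₁ : (p : ℕ) < i
  · have e : permNat σ p = σ ⟨p, by omega⟩ := permNat_coe σ ⟨p, by omega⟩
    rw [dif_pos h₁, if_pos h₁, e]
    split_ifs <;> first | rfl | omega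
  · rw [dif_neg h₁, if_neg h₁]
    by_cases h₂ : (p : ℕ) ≤ i + m
    · have e : permNat τ (p - i) = τ ⟨p - i, by omega⟩ := permNat_coe τ ⟨p - i, by omega⟩
      rw [dif_pos h₂, if_pos h₂, e]
    · have e : permNat σ (p - m) = σ ⟨p - m, by omega⟩ := permNat_coe σ ⟨p - m, by omega⟩
      rw [dif_neg h₂, if_neg h₂, e]
      split_ifs <;> first | rfl | omega

theorem insertFun_injective {n m : ℕ} (i : Fin (n + 1)) (σ : Equiv.Perm (Fin (n + 1)))
    (τ : Equiv.Perm (Fin (m + 1))) : Function.Injective (insertFun i σ τ) := by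
  intro p q h
  have h' := congrArg Fin.val h
  rw [insertFun_val, insertFun_val] at h'
  unfold insertNat at h'
  have hp := p.2
  have hq := q.2
  have hi := i.2
  have := permNat_inj σ
  have := permNat_inj τ
  have := permNat_lt τ
  apply Fin.ext
  grind

/-- The permutation `Bᵢ(σ, τ)`. -/
noncomputable def insertPerm {n m : ℕ} (i : Fin (n + 1)) (σ : Equiv.Perm (Fin (n + 1)))
    (τ : Equiv.Perm (Fin (m + 1))) : Equiv.Perm (Fin (n + m + 1)) :=
  Equiv.ofBijective (insertFun i σ τ)
    (Finite.injective_iff_bijective.mp (insertFun_injective i σ τ))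

theorem permNat_insertPerm {n m : ℕ} (i : Fin (n + 1)) (σ : Equiv.Perm (Fin (n + 1)))
    (τ : Equiv.Perm (Fin (m + 1))) (p : ℕ) (hp : p < n + m + 1) :
    permNat (insertPerm i σ τ) p = insertNat i m (permNat σ) (permNat τ) p := by
  have h₁ := permNat_coe (insertPerm i σ τ) ⟨p, hp⟩
  have h₂ := insertFun_val i σ τ ⟨p, hp⟩
  exact h₁.trans h₂

theorem insertNat_congr {i m N : ℕ} {s s' t t' : ℕ → ℕ} (hi : i < N)
    (hs : ∀ p < N, s p = s' p) (ht : ∀ p < m + 1, t p = t' p) {p : ℕ} (hp : p < N + m) :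
    insertNat i m s t p = insertNat i m s' t' p := by
  unfold insertNat
  rw [hs i hi]
  by_cases h₁ : p < i
  · rw [if_pos h₁, if_pos h₁, hs p (by omega)]
  · by_cases h₂ : p ≤ i + m
    · rw [if_neg h₁, if_neg h₁, if_pos h₂, if_pos h₂, ht _ (by omega)]
    · rw [if_neg h₁, if_neg h₁, if_neg h₂, if_neg h₂, hs _ (by omega)]

theorem insertNat_lt {i m p : ℕ} (s t : ℕ → ℕ) (h : p < i) :
    insertNat i m s t p = if s p < s i then s p else s p + m := by
  rw [insertNat, if_pos h]

theorem insertNat_mid {i m p : ℕ} (s t : ℕ → ℕ) (h : i ≤ p) (h' : p ≤ i + m) :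
    insertNat i m s t p = s i + t (p - i) := by
  rw [insertNat, if_neg (by omega), if_pos h']

theorem insertNat_gt {i m p : ℕ} (s t : ℕ → ℕ) (h : i + m < p) :
    insertNat i m s t p = if s (p - m) < s i then s (p - m) else s (p - m) + m := by
  rw [insertNat, if_neg (by omega), if_neg (by omega)]

theorem insertNat_parallel {i j m l : ℕ} (hij : i < j) {s t u : ℕ → ℕ}
    (hs : s i ≠ s j) (ht : ∀ p, t p ≤ m) (hu : ∀ p, u p ≤ l) (p : ℕ) :
    insertNat (j + m) l (insertNat i m s t) u p = insertNat i m (insertNat j l s u) t p := by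
  have e₁ : insertNat i m s t (j + m) = if s j < s i then s j else s j + m := by
    rw [insertNat_gt _ _ (by omega), Nat.add_sub_cancel]
  have e₂ : insertNat j l s u i = if s i < s j then s i else s i + l := insertNat_lt _ _ hij
  have ht' := ht (p - i)
  have hu' := hu (p - m - j)
  by_cases c₁ : p < i
  · rw [insertNat_lt (insertNat i m s t) u (by omega), insertNat_lt (insertNat j l s u) t c₁, e₁, e₂,
      insertNat_lt s t c₁, insertNat_lt s u (by omega)]
    split_ifs <;> omega
  by_cases c₂ : p ≤ i + m
  · rw [insertNat_lt (insertNat i m s t) u (by omega), insertNat_mid (insertNat j l s u) t (by omega) c₂,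
      e₁, e₂, insertNat_mid s t (by omega) c₂]
    split_ifs <;> omega
  by_cases c₃ : p < j + m
  · rw [insertNat_lt (insertNat i m s t) u (by omega), insertNat_gt (insertNat j l s u) t (by omega),
      e₁, e₂, insertNat_gt s t (by omega), insertNat_lt s u (by omega)]
    split_ifs <;> omega
  by_cases c₄ : p ≤ j + m + l
  · rw [insertNat_mid (insertNat i m s t) u (by omega) c₄, insertNat_gt (insertNat j l s u) t (by omega),
      e₁, e₂, insertNat_mid s u (by omega) (by omega), show p - (j + m) = p - m - j by omega]
    split_ifs <;> omega
  · rw [insertNat_gt (insertNat i m s t) u (by omega), insertNat_gt (insertNat j l s u) t (by omega),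
      e₁, e₂, insertNat_gt s t (by omega), insertNat_gt s u (by omega), Nat.sub_right_comm p l m]
    split_ifs <;> omega

theorem insertNat_nested {i j m l : ℕ} (hj : j ≤ m) {s t u : ℕ → ℕ}
    (ht : ∀ p, t p ≤ m) (hu : ∀ p, u p ≤ l) (p : ℕ) :
    insertNat (i + j) l (insertNat i m s t) u p = insertNat i (m + l) s (insertNat j l t u) p := by
  have e : insertNat i m s t (i + j) = s i + t j := by
    unfold insertNat
    rw [if_neg (by omega), if_pos (by omega), Nat.add_sub_cancel_left]
  have ht' := ht (p - i)
  have htj := ht j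
  have hu' := hu (p - i - j)
  have ht'' := ht (p - i - l)
  rw [insertNat, e]
  unfold insertNat
  rw [show p - (i + j) = p - i - j by omega, show p - l - i = p - i - l by omega,
    show p - (m + l) = p - l - m by omega]
  by_cases c₁ : p < i
  · split_ifs <;> omega
  by_cases c₂ : p < i + j
  · split_ifs <;> omega
  by_cases c₃ : p ≤ i + j + l
  · split_ifs <;> omega
  by_cases c₄ : p ≤ i + m + l
  · split_ifs <;> omega
  · split_ifs <;> omega

theorem perm_heq_of_permNat {a b : ℕ} (h : a = b) (σ : Equiv.Perm (Fin (a + 1)))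
    (τ : Equiv.Perm (Fin (b + 1))) (hst : ∀ p < a + 1, permNat σ p = permNat τ p) :
    HEq σ τ := by
  subst h
  apply heq_of_eq
  ext p
  have := hst p p.2
  rwa [permNat_coe, permNat_coe] at this

/-- The partial composition `F_σ ∘ᵢ F_τ = F_{Bᵢ(σ, τ)}`, extended bilinearly. -/
noncomputable def asComp (k : Type*) [CommRing k] {n m : ℕ} (i : Fin (n + 1)) :
    AsMod k n →ₗ[k] AsMod k m →ₗ[k] AsMod k (n + m) :=
  Finsupp.lift (AsMod k m →ₗ[k] AsMod k (n + m)) k (Equiv.Perm (Fin (n + 1))) fun σ =>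
    Finsupp.lift (AsMod k (n + m)) k (Equiv.Perm (Fin (m + 1))) fun τ =>
      Finsupp.single (insertPerm i σ τ) 1

theorem asComp_single (k : Type*) [CommRing k] {n m : ℕ} (i : Fin (n + 1))
    (σ : Equiv.Perm (Fin (n + 1))) (τ : Equiv.Perm (Fin (m + 1))) (r s : k) :
    asComp k i (Finsupp.single σ r) (Finsupp.single τ s) =
      Finsupp.single (insertPerm i σ τ) (r * s) := by
  simp [asComp]

/-- Transport along an equality of arities, as a linear map. -/
noncomputable def asCast (k : Type*) [CommRing k] {a b : ℕ} (h : a = b) : AsMod k a →ₗ[k] AsMod k b :=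
  h ▸ LinearMap.id

theorem asCast_heq (k : Type*) [CommRing k] {a b : ℕ} (h : a = b) (x : AsMod k a) :
    HEq (asCast k h x) x := by
  subst h; rfl

theorem asCast_single (k : Type*) [CommRing k] {a b : ℕ} (h : a = b)
    (σ : Equiv.Perm (Fin (a + 1))) (τ : Equiv.Perm (Fin (b + 1))) (hst : HEq σ τ) (r : k) :
    asCast k h (Finsupp.single σ r) = Finsupp.single τ r := by
  subst h; obtain rfl := eq_of_heq hst; rfl

theorem insertPerm_parallel {n m l : ℕ} (i j : Fin (n + 1)) (hij : i < j)
    (σ : Equiv.Perm (Fin (n + 1))) (τ : Equiv.Perm (Fin (m + 1)))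
    (υ : Equiv.Perm (Fin (l + 1))) :
    HEq (insertPerm (⟨j + m, by omega⟩ : Fin (n + m + 1)) (insertPerm i σ τ) υ)
      (insertPerm (⟨i, by omega⟩ : Fin (n + l + 1)) (insertPerm j σ υ) τ) := by
  apply perm_heq_of_permNat (by omega)
  intro p hp
  have hi := i.2
  have hj := j.2
  have hij' : (i : ℕ) < j := hij
  rw [permNat_insertPerm _ (insertPerm i σ τ) υ p hp,
    permNat_insertPerm _ (insertPerm j σ υ) τ p (by omega),
    insertNat_congr (N := n + m + 1) (by omega) (permNat_insertPerm i σ τ)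
      (fun _ _ => rfl) (by omega),
    insertNat_congr (N := n + l + 1) (by omega) (permNat_insertPerm j σ υ)
      (fun _ _ => rfl) (by omega)]
  exact insertNat_parallel hij' (fun h => absurd (permNat_inj σ _ _ hi hj h) (by omega))
    (fun q => Nat.le_of_lt_succ (permNat_lt τ q)) (fun q => Nat.le_of_lt_succ (permNat_lt υ q)) p

theorem insertPerm_nested {n m l : ℕ} (i : Fin (n + 1)) (j : Fin (m + 1))
    (σ : Equiv.Perm (Fin (n + 1))) (τ : Equiv.Perm (Fin (m + 1)))
    (υ : Equiv.Perm (Fin (l + 1))) :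
    HEq (insertPerm (⟨i + j, by omega⟩ : Fin (n + m + 1)) (insertPerm i σ τ) υ)
      (insertPerm i σ (insertPerm j τ υ)) := by
  apply perm_heq_of_permNat (by omega)
  intro p hp
  have hi := i.2
  have hj := j.2
  rw [permNat_insertPerm _ (insertPerm i σ τ) υ p hp,
    permNat_insertPerm _ σ (insertPerm j τ υ) p (by omega),
    insertNat_congr (N := n + m + 1) (by omega) (permNat_insertPerm i σ τ)
      (fun _ _ => rfl) (by omega),
    insertNat_congr (N := n + 1) (s := permNat σ) hi (fun _ _ => rfl)
      (permNat_insertPerm j τ υ) (by omega)]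
  exact insertNat_nested (by omega) (fun q => Nat.le_of_lt_succ (permNat_lt τ q))
    (fun q => Nat.le_of_lt_succ (permNat_lt υ q)) p

theorem insertPerm_one {n : ℕ} (i : Fin (n + 1)) (σ : Equiv.Perm (Fin (n + 1))) :
    insertPerm i σ (1 : Equiv.Perm (Fin (0 + 1))) = σ := by
  apply eq_of_heq
  apply perm_heq_of_permNat rfl
  intro p hp
  have h := permNat_lt (1 : Equiv.Perm (Fin (0 + 1)))
  rw [permNat_insertPerm _ _ _ _ hp]
  unfold insertNat
  grind

theorem one_insertPerm {n : ℕ} (σ : Equiv.Perm (Fin (n + 1))) :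
    HEq (insertPerm 0 (1 : Equiv.Perm (Fin (0 + 1))) σ) σ := by
  apply perm_heq_of_permNat (by omega)
  intro p hp
  have h := permNat_lt (1 : Equiv.Perm (Fin (0 + 1)))
  rw [permNat_insertPerm _ _ _ _ hp]
  unfold insertNat
  simp only [Fin.val_zero]
  grind

/-- The non-symmetric associative operad: the modules `k S_{n+1}` with
`F_σ ∘ᵢ F_τ = F_{Bᵢ(σ, τ)}` and unit `F_1` in arity one. -/
noncomputable def assocOperad (k : Type*) [CommRing k] : NSOperad k (AsMod k) where
  comp := asComp k
  one := Finsupp.single 1 1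
  assoc_parallel := by
    intro n m l i j hij x y z
    have key : asCast k (by omega)
        (asComp k (⟨j + m, by omega⟩ : Fin (n + m + 1)) (asComp k i x y) z) =
        asComp k (⟨i, by omega⟩ : Fin (n + l + 1)) (asComp k j x z) y := by
      induction x using Finsupp.induction_linear with
      | zero => simp
      | add f g hf hg => simp only [map_add, LinearMap.add_apply, hf, hg]
      | single σ r =>
      induction y using Finsupp.induction_linear with
      | zero => simp
      | add f g hf hg => simp only [map_add, LinearMap.add_apply, hf, hg]
      | single τ s =>
      induction z using Finsupp.induction_linear with
      | zero => simp
      | add f g hf hg => simp only [map_add, LinearMap.add_apply, hf, hg]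
      | single υ t =>
        simp only [asComp_single]
        rw [asCast_single k _ _ _ (insertPerm_parallel i j hij σ τ υ)]
        congr 1; ring
    exact (asCast_heq k _ _).symm.trans (heq_of_eq key)
  assoc_nested := by
    intro n m l i j x y z
    have key : asCast k (by omega)
        (asComp k (⟨i + j, by omega⟩ : Fin (n + m + 1)) (asComp k i x y) z) =
        asComp k i x (asComp k j y z) := by
      induction x using Finsupp.induction_linear with
      | zero => simp
      | add f g hf hg => simp only [map_add, LinearMap.add_apply, hf, hg]
      | single σ r =>
      induction y using Finsupp.induction_linear with
      | zero => simp
      | add f g hf hg => simp only [map_add, LinearMap.add_apply, hf, hg]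
      | single τ s =>
      induction z using Finsupp.induction_linear with
      | zero => simp
      | add f g hf hg => simp only [map_add, hf, hg]
      | single υ t =>
        simp only [asComp_single]
        rw [asCast_single k _ _ _ (insertPerm_nested i j σ τ υ)]
        congr 1; ring
    exact (asCast_heq k _ _).symm.trans (heq_of_eq key)
  comp_one := by
    intro n i x
    induction x using Finsupp.induction_linear with
    | zero => simp
    | add f g hf hg => simp only [map_add, LinearMap.add_apply, hf, hg]
    | single σ r =>
      rw [asComp_single, mul_one]
      exact congrArg (fun ρ => Finsupp.single ρ r) (insertPerm_one i σ)
  one_comp := by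
    intro n x
    have key : asCast k (by omega)
        (asComp k 0 (Finsupp.single (1 : Equiv.Perm (Fin (0 + 1))) (1 : k)) x) = x := by
      induction x using Finsupp.induction_linear with
      | zero => simp
      | add f g hf hg => simp only [map_add, hf, hg]
      | single σ r =>
        rw [asComp_single, asCast_single k _ _ _ (one_insertPerm σ), one_mul]
    exact (asCast_heq k _ _).symm.trans (heq_of_eq key)

/-! ### The coalgebra of permutations, descents, and the Hopf kernel -/

/-- The standardization of a sequence of distinct elements of a linear order: the inverse of the
permutation which sorts it (see `standardize_lt_iff` for its characterization). -/
def standardize {m : ℕ} {α : Type*} [LinearOrder α] (a : Fin m → α) : Equiv.Perm (Fin m) :=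
  (Tuple.sort a)⁻¹

theorem standardize_lt_iff {m : ℕ} {α : Type*} [LinearOrder α] (a : Fin m → α)
    (ha : Function.Injective a) (i j : Fin m) :
    standardize a i < standardize a j ↔ a i < a j := by
  have hm : StrictMono (a ∘ Tuple.sort a) :=
    (Tuple.monotone_sort a).strictMono_of_injective (ha.comp (Tuple.sort a).injective)
  have := hm.lt_iff_lt (a := standardize a i) (b := standardize a j)
  simpa [standardize] using this.symm

/-- `H = ⨁_{n ≥ 1} k S_n`; the summand of index `n` has degree `n + 1`. -/
abbrev PermSpace (k : Type*) [CommRing k] : Type _ := ⨁ n : ℕ, AsMod k n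

/-- The module with basis `F_S`, for `S` a subset of `[n]` (degree `n + 1`). -/
abbrev QMod (k : Type*) [CommRing k] (n : ℕ) : Type _ := Finset (Fin n) →₀ k

/-- The space `⨁_{n ≥ 1} k Q_n` of quasi-symmetric functions (of positive degree), with
`Q_n` the set of subsets of `[n - 1]`. -/
abbrev QSymSpace (k : Type*) [CommRing k] : Type _ := ⨁ n : ℕ, QMod k n

/-- The standardization of the first `p + 1` letters of `σ ∈ S_{n+1}`, where `p < n`. -/
def stPrefix {n : ℕ} (σ : Equiv.Perm (Fin (n + 1))) (p : Fin n) :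
    Equiv.Perm (Fin ((p : ℕ) + 1)) :=
  standardize fun j : Fin ((p : ℕ) + 1) => σ ⟨j, by omega⟩

/-- The standardization of the remaining `n - p = (n - 1 - p) + 1` letters of `σ ∈ S_{n+1}`. -/
def stSuffix {n : ℕ} (σ : Equiv.Perm (Fin (n + 1))) (p : Fin n) :
    Equiv.Perm (Fin ((n - 1 - (p : ℕ)) + 1)) :=
  standardize fun j : Fin ((n - 1 - (p : ℕ)) + 1) => σ ⟨(p : ℕ) + 1 + j, by omega⟩

/-- The (non-counital) coproduct `Δ(F_σ) = ∑ F_{st(σ₁,…,σᵢ)} ⊗ F_{st(σᵢ₊₁,…,σₙ)}`, the sum being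
over all ways of cutting `σ` in two non-empty words. -/
noncomputable def coproduct (k : Type*) [CommRing k] :
    PermSpace k →ₗ[k] PermSpace k ⊗[k] PermSpace k :=
  DirectSum.toModule k ℕ (PermSpace k ⊗[k] PermSpace k) fun n =>
    Finsupp.lift (PermSpace k ⊗[k] PermSpace k) k (Equiv.Perm (Fin (n + 1))) fun σ =>
      ∑ p : Fin n,
        DirectSum.lof k ℕ (AsMod k) (p : ℕ) (Finsupp.single (stPrefix σ p) 1) ⊗ₜ[k]
          DirectSum.lof k ℕ (AsMod k) (n - 1 - (p : ℕ)) (Finsupp.single (stSuffix σ p) 1)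

/-- The descent set of a permutation. -/
def descents {n : ℕ} (σ : Equiv.Perm (Fin (n + 1))) : Finset (Fin n) :=
  Finset.univ.filter fun p => σ p.castSucc > σ p.succ

/-- The descent map `D(F_σ) = F_{Des(σ)}`. -/
noncomputable def descentMap (k : Type*) [CommRing k] : PermSpace k →ₗ[k] QSymSpace k :=
  DirectSum.lmap fun n =>
    Finsupp.lift (QMod k n) k (Equiv.Perm (Fin (n + 1))) fun σ => Finsupp.single (descents σ) 1

/-- The Hopf kernel `ker D ∩ ker ((id ⊗ D) ∘ Δ)`. -/
noncomputable def hopfKernel (k : Type*) [CommRing k] : Submodule k (PermSpace k) :=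
  LinearMap.ker (descentMap k) ⊓
    LinearMap.ker (LinearMap.lTensor (PermSpace k) (descentMap k) ∘ₗ coproduct k)

/-- The homogeneous component of degree `n + 1` of the Hopf kernel, as a submodule
of `k S_{n+1}`. -/
noncomputable def hopfKernelComponent (k : Type*) [CommRing k] (n : ℕ) :
    Submodule k (AsMod k n) :=
  (hopfKernel k).comap (DirectSum.lof k ℕ (AsMod k) n)

/-!
An element `x` of `k S_{n+1}` lies in the Hopf kernel if and only if, for each cut `q ≤ n`, it dies
when two basis elements `F_σ` are identified as soon as the first `q` letters of the permutations
have the same relative order and the remaining words have the same descents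
(`mem_hopfKernelComponent_iff`). The cut `q = 0` is the condition `D x = 0`. The cuts `q ≥ 1` are
the components of `(id ⊗ D) (Δ x) = 0` in the various bidegrees, which are pairwise distinct and so
vanish separately.

Now consider a cut of `Bᵢ(σ, τ)`. Two letters of this word compare as letters of `τ` if both lie in
the inserted block, and as letters of `σ` otherwise (`insertNat_lt_insertNat_iff`). Hence, if the
cut precedes the end of the block, then for fixed `σ` the class of `Bᵢ(σ, τ)` depends only on the
class of `τ` for a cut of `τ`, which is the cut `0` if the block is not split; so `F_σ ∘ᵢ y` dies
because `y` lies in the Hopf kernel. If the cut comes after the block, then for fixed `τ` the class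
of `Bᵢ(σ, τ)` depends only on the class of `σ` for a cut of `σ`, and `x ∘ᵢ F_τ` dies because `x`
lies in the Hopf kernel. Bilinearity of `∘ᵢ` gives the general case.
-/

/-! ### Comparing the letters of a composite -/

/-- The position in `s` of the letter from which the letter of `insertNat i m s t` at position `p`
arises: the inserted block `[i, i + m]` collapses to `i`. -/
def collapse (i m p : ℕ) : ℕ :=
  if p < i then p else if p ≤ i + m then i else p - m

theorem collapse_lt {i m n p : ℕ} (hi : i < n + 1) (hp : p < n + m + 1) :
    collapse i m p < n + 1 := by
  unfold collapse; split_ifs <;> omega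

/-- Two letters of a composite compare as the corresponding letters of `t` if both lie in the
inserted block, and as the letters of `s` they come from otherwise. -/
theorem insertNat_lt_insertNat_iff {i m n : ℕ} (hi : i < n + 1) {s t : ℕ → ℕ}
    (hs : ∀ p q, p < n + 1 → q < n + 1 → s p = s q → p = q) (ht : ∀ p, t p < m + 1)
    {a b : ℕ} (ha : a < n + m + 1) (hb : b < n + m + 1) :
    insertNat i m s t a < insertNat i m s t b ↔
      if collapse i m a = i ∧ collapse i m b = i then t (a - i) < t (b - i)
      else s (collapse i m a) < s (collapse i m b) := by
  have hta := ht (a - i)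
  have htb := ht (b - i)
  have hsa : s (collapse i m a) = s i → collapse i m a = i :=
    hs _ _ (collapse_lt hi ha) hi
  have hsb : s (collapse i m b) = s i → collapse i m b = i :=
    hs _ _ (collapse_lt hi hb) hi
  have key : ∀ p, insertNat i m s t p = if collapse i m p = i then s i + t (p - i) else
      if s (collapse i m p) < s i then s (collapse i m p) else s (collapse i m p) + m := by
    intro p
    unfold insertNat collapse
    split_ifs <;> first | rfl | omega
  rw [key a, key b]
  by_cases h₁ : collapse i m a = i <;> by_cases h₂ : collapse i m b = i <;>
    simp only [h₁, h₂, if_true, if_false, and_self, and_true, and_false, imp_false] at hsa hsb ⊢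
  · omega
  · split_ifs <;> omega
  · split_ifs <;> omega
  · split_ifs <;> omega

/-! ### Cutting permutations -/

/-- Two permutations are equivalent for the cut at `q` if their first `q` letters are in the same
relative order, and their words of remaining letters have the same descents. -/
def cutSetoid (n q : ℕ) : Setoid (Equiv.Perm (Fin (n + 1))) where
  r σ τ :=
    (∀ a b, a < q → b < q → a < n + 1 → b < n + 1 →
      (permNat σ a < permNat σ b ↔ permNat τ a < permNat τ b)) ∧
    (∀ a, q ≤ a → a + 1 < n + 1 →
      (permNat σ (a + 1) < permNat σ a ↔ permNat τ (a + 1) < permNat τ a))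
  iseqv :=
    { refl := fun _ => ⟨fun _ _ _ _ _ _ => Iff.rfl, fun _ _ _ => Iff.rfl⟩
      symm := fun h => ⟨fun a b ha hb ha' hb' => (h.1 a b ha hb ha' hb').symm,
        fun a ha ha' => (h.2 a ha ha').symm⟩
      trans := fun h h' =>
        ⟨fun a b ha hb ha' hb' => (h.1 a b ha hb ha' hb').trans (h'.1 a b ha hb ha' hb'),
          fun a ha ha' => (h.2 a ha ha').trans (h'.2 a ha ha')⟩ }

/-- A cut of `Bᵢ(σ, τ)` before the end of the inserted block sees `τ` only through its cut at
`q - i`. If the cut precedes the block, the subtraction truncates to `0`, and only the descents of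
`τ` matter. -/
theorem cutSetoid_insertPerm_right {n m q : ℕ} (i : Fin (n + 1)) (hq : q ≤ i + m)
    (σ : Equiv.Perm (Fin (n + 1))) {τ τ' : Equiv.Perm (Fin (m + 1))}
    (h : cutSetoid m (q - i) τ τ') :
    cutSetoid (n + m) q (insertPerm i σ τ) (insertPerm i σ τ') := by
  obtain ⟨h₁, h₂⟩ := h
  have hi := i.2
  constructor
  · intro a b ha hb ha' hb'
    rw [permNat_insertPerm _ _ _ _ ha', permNat_insertPerm _ _ _ _ hb',
      permNat_insertPerm _ _ _ _ ha', permNat_insertPerm _ _ _ _ hb',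
      insertNat_lt_insertNat_iff hi (permNat_inj σ) (permNat_lt τ) ha' hb',
      insertNat_lt_insertNat_iff hi (permNat_inj σ) (permNat_lt τ') ha' hb']
    split_ifs with hc
    · unfold collapse at hc
      exact h₁ _ _ (by grind) (by grind) (by omega) (by omega)
    · rfl
  · intro a ha ha'
    rw [permNat_insertPerm _ _ _ _ ha', permNat_insertPerm _ _ _ a (by omega),
      permNat_insertPerm _ _ _ _ ha', permNat_insertPerm _ _ _ a (by omega),
      insertNat_lt_insertNat_iff hi (permNat_inj σ) (permNat_lt τ) ha' (by omega),
      insertNat_lt_insertNat_iff hi (permNat_inj σ) (permNat_lt τ') ha' (by omega)]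
    split_ifs with hc
    · unfold collapse at hc
      have e : a + 1 - i = a - i + 1 := by grind
      rw [e]
      refine h₂ _ (by omega) ?_
      grind
    · rfl

/-- A cut of `Bᵢ(σ, τ)` after the inserted block sees `σ` only through its cut at `q - m`. -/
theorem cutSetoid_insertPerm_left {n m q : ℕ} (i : Fin (n + 1)) (hq : i + m < q)
    {σ σ' : Equiv.Perm (Fin (n + 1))} (τ : Equiv.Perm (Fin (m + 1)))
    (h : cutSetoid n (q - m) σ σ') :
    cutSetoid (n + m) q (insertPerm i σ τ) (insertPerm i σ' τ) := by
  obtain ⟨h₁, h₂⟩ := h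
  have hi := i.2
  constructor
  · intro a b ha hb ha' hb'
    rw [permNat_insertPerm _ _ _ _ ha', permNat_insertPerm _ _ _ _ hb',
      permNat_insertPerm _ _ _ _ ha', permNat_insertPerm _ _ _ _ hb',
      insertNat_lt_insertNat_iff hi (permNat_inj σ) (permNat_lt τ) ha' hb',
      insertNat_lt_insertNat_iff hi (permNat_inj σ') (permNat_lt τ) ha' hb']
    have key : ∀ p < q, collapse i m p < q - m := by
      intro p hp; unfold collapse; split_ifs <;> omega
    split_ifs with hc
    · rfl
    · exact h₁ _ _ (key a ha) (key b hb) (collapse_lt hi ha') (collapse_lt hi hb')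
  · intro a ha ha'
    rw [permNat_insertPerm _ _ _ _ ha', permNat_insertPerm _ _ _ a (by omega),
      permNat_insertPerm _ _ _ _ ha', permNat_insertPerm _ _ _ a (by omega),
      insertNat_lt_insertNat_iff hi (permNat_inj σ) (permNat_lt τ) ha' (by omega),
      insertNat_lt_insertNat_iff hi (permNat_inj σ') (permNat_lt τ) ha' (by omega)]
    have e : collapse i m a = a - m := by grind [collapse]
    have e' : collapse i m (a + 1) = a - m + 1 := by grind [collapse]
    rw [e, e', if_neg (by omega), if_neg (by omega)]
    exact h₂ (a - m) (by omega) (by omega)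

theorem mem_descents_iff {n : ℕ} (σ : Equiv.Perm (Fin (n + 1))) (a : Fin n) :
    a ∈ descents σ ↔ permNat σ (a + 1) < permNat σ a := by
  have h₁ := permNat_coe σ a.succ
  have h₂ := permNat_coe σ a.castSucc
  simp only [Fin.val_succ, Fin.val_castSucc] at h₁ h₂
  simp [descents, h₁, h₂]

theorem descents_eq_iff_cutSetoid {n : ℕ} (σ τ : Equiv.Perm (Fin (n + 1))) :
    descents σ = descents τ ↔ cutSetoid n 0 σ τ := by
  simp only [Finset.ext_iff, mem_descents_iff]
  constructor
  · exact fun h => ⟨fun a b ha => absurd ha (by omega),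
      fun a _ ha => h ⟨a, Nat.lt_of_succ_lt_succ ha⟩⟩
  · exact fun h a => h.2 a (by omega) (by omega)

theorem standardize_eq_iff {m : ℕ} {α : Type*} [LinearOrder α] {a b : Fin m → α}
    (ha : Function.Injective a) (hb : Function.Injective b) :
    standardize a = standardize b ↔ ∀ i j, a i < a j ↔ b i < b j := by
  constructor
  · intro h i j
    rw [← standardize_lt_iff a ha, ← standardize_lt_iff b hb, h]
  · intro h
    -- A strictly increasing self-bijection of `Fin m` is the identity.
    have hm : StrictMono ((standardize a)⁻¹.trans (standardize b)) := by
      intro i j hij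
      simp only [Equiv.trans_apply]
      rw [standardize_lt_iff b hb, ← h, ← standardize_lt_iff a ha]
      simpa using hij
    have hid : ∀ i, ((standardize a)⁻¹.trans (standardize b)) i = i := by
      intro i
      have := Subsingleton.elim
        (StrictMono.orderIsoOfSurjective _ hm (Equiv.surjective _)) (OrderIso.refl (Fin m))
      exact congrArg (fun e : Fin m ≃o Fin m => e i) this
    ext i
    have := hid (standardize a i)
    rw [Equiv.trans_apply] at this
    change standardize b ((standardize a).symm (standardize a i)) = _ at this
    rw [Equiv.symm_apply_apply] at this
    rw [this]

theorem stPrefix_injective {n : ℕ} (σ : Equiv.Perm (Fin (n + 1))) (p : Fin n) :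
    Function.Injective fun j : Fin ((p : ℕ) + 1) => σ ⟨j, by omega⟩ := by
  intro a b h
  have := σ.injective h
  simpa [Fin.ext_iff] using this

theorem stSuffix_injective {n : ℕ} (σ : Equiv.Perm (Fin (n + 1))) (p : Fin n) :
    Function.Injective fun j : Fin ((n - 1 - (p : ℕ)) + 1) => σ ⟨(p : ℕ) + 1 + j, by omega⟩ := by
  intro a b h
  have := σ.injective h
  simpa [Fin.ext_iff] using this

theorem mem_descents_stSuffix {n : ℕ} (σ : Equiv.Perm (Fin (n + 1))) (p : Fin n)
    (a : Fin (n - 1 - (p : ℕ))) :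
    a ∈ descents (stSuffix σ p) ↔
      permNat σ (p + 1 + a + 1) < permNat σ (p + 1 + a) := by
  have h₁ := permNat_coe σ ⟨p + 1 + a + 1, by omega⟩
  have h₂ := permNat_coe σ ⟨p + 1 + a, by omega⟩
  simp only at h₁ h₂
  rw [h₁, h₂]
  simp only [descents, Finset.mem_filter, Finset.mem_univ, true_and, gt_iff_lt, stSuffix]
  rw [standardize_lt_iff _ (stSuffix_injective σ p)]
  rfl

theorem stPrefix_descents_eq_iff_cutSetoid {n : ℕ} (p : Fin n) (σ τ : Equiv.Perm (Fin (n + 1))) :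
    (stPrefix σ p, descents (stSuffix σ p)) = (stPrefix τ p, descents (stSuffix τ p)) ↔
      cutSetoid n (p + 1) σ τ := by
  rw [Prod.mk.injEq, stPrefix, stPrefix,
    standardize_eq_iff (stPrefix_injective σ p) (stPrefix_injective τ p), Finset.ext_iff]
  simp only [mem_descents_stSuffix]
  have e : ∀ (ρ : Equiv.Perm (Fin (n + 1))) (a b : ℕ) (ha : a < n + 1) (hb : b < n + 1),
      ρ ⟨a, ha⟩ < ρ ⟨b, hb⟩ ↔ permNat ρ a < permNat ρ b := by
    intro ρ a b ha hb
    simp [permNat, ha, hb]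
  simp only [e]
  constructor
  · rintro ⟨h₁, h₂⟩
    refine ⟨fun a b ha hb _ _ => h₁ ⟨a, ha⟩ ⟨b, hb⟩, fun a ha ha' => ?_⟩
    have := h₂ ⟨a - (p + 1), by omega⟩
    simpa only [Nat.add_sub_cancel' ha] using this
  · rintro ⟨h₁, h₂⟩
    exact ⟨fun a b => h₁ a b a.2 b.2 (by omega) (by omega),
      fun a => h₂ _ (by omega) (by omega)⟩

/-! ### The Hopf kernel in terms of cuts -/

/-- Whether `mapDomain` annihilates an element depends only on the fibres of the map. -/
theorem mapDomain_eq_zero_of_fibers {k α β γ : Type*} [AddCommMonoid k] {f : α → β} {g : α → γ}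
    (h : ∀ a b, f a = f b → g a = g b) {x : α →₀ k} (hx : x.mapDomain f = 0) :
    x.mapDomain g = 0 := by
  cases isEmpty_or_nonempty α with
  | inl _ => rw [Subsingleton.elim x 0, Finsupp.mapDomain_zero]
  | inr hα =>
    have : g = (fun b => g (Function.invFun f b)) ∘ f := by
      funext a
      exact (h _ _ (Function.invFun_eq ⟨a, rfl⟩)).symm
    rw [this, Finsupp.mapDomain_comp, hx, Finsupp.mapDomain_zero]

/-- The part of `(id ⊗ D) ∘ Δ` in the bidegree given by the cut after position `p`, with the tensor
product of free modules written as the free module on pairs. -/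
noncomputable def cutMap (k : Type*) [CommRing k] (n : ℕ) (p : Fin n) :
    AsMod k n →ₗ[k] (Equiv.Perm (Fin ((p : ℕ) + 1)) × Finset (Fin (n - 1 - (p : ℕ))) →₀ k) :=
  Finsupp.lmapDomain k k fun σ => (stPrefix σ p, descents (stSuffix σ p))

theorem descentMap_lof (k : Type*) [CommRing k] (n : ℕ) (x : AsMod k n) :
    descentMap k (DirectSum.lof k ℕ (AsMod k) n x) =
      DirectSum.lof k ℕ (QMod k) n (x.mapDomain descents) := by
  rw [descentMap, DirectSum.lmap_lof]
  congr 1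
  induction x using Finsupp.induction_linear with
  | zero => simp
  | add f g hf hg => rw [map_add, hf, hg, Finsupp.mapDomain_add]
  | single σ r => simp

theorem lTensor_coproduct_lof (k : Type*) [CommRing k] (n : ℕ) (x : AsMod k n) :
    LinearMap.lTensor (PermSpace k) (descentMap k)
        (coproduct k (DirectSum.lof k ℕ (AsMod k) n x)) =
      ∑ p : Fin n,
        TensorProduct.map (DirectSum.lof k ℕ (AsMod k) (p : ℕ))
            (DirectSum.lof k ℕ (QMod k) (n - 1 - (p : ℕ)))
          ((finsuppTensorFinsupp' k _ _).symm (cutMap k n p x)) := by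
  induction x using Finsupp.induction_linear with
  | zero => simp
  | add f g hf hg => simp only [map_add, hf, hg, Finset.sum_add_distrib]
  | single σ r =>
    have : (Finsupp.single σ r : AsMod k n) = r • Finsupp.single σ 1 := by simp
    rw [this]
    simp only [map_smul, ← Finset.smul_sum]
    congr 1
    rw [coproduct, DirectSum.toModule_lof]
    simp only [Finsupp.lift_apply, Finsupp.sum_single_index, zero_smul, one_smul, map_sum,
      LinearMap.lTensor_tmul, descentMap_lof, Finsupp.mapDomain_single, cutMap,
      Finsupp.lmapDomain_apply]
    refine Finset.sum_congr rfl fun p _ => ?_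
    rw [finsuppTensorFinsupp'_symm_single_eq_single_one_tmul, TensorProduct.map_tmul]

theorem lTensor_coproduct_lof_eq_zero_iff (k : Type*) [CommRing k] (n : ℕ) (x : AsMod k n) :
    LinearMap.lTensor (PermSpace k) (descentMap k)
        (coproduct k (DirectSum.lof k ℕ (AsMod k) n x)) = 0 ↔
      ∀ p : Fin n, cutMap k n p x = 0 := by
  rw [lTensor_coproduct_lof]
  constructor
  · intro h p
    -- Distinct cuts land in distinct bidegrees, so projecting onto one isolates its term.
    have h' := congrArg (finsuppTensorFinsupp' k _ _ ∘
      TensorProduct.map (DirectSum.component k ℕ (AsMod k) (p : ℕ))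
        (DirectSum.component k ℕ (QMod k) (n - 1 - (p : ℕ)))) h
    simp only [Function.comp_apply, map_sum, map_zero] at h'
    rw [Finset.sum_eq_single p] at h'
    · rw [← LinearMap.comp_apply (TensorProduct.map _ _), ← TensorProduct.map_comp] at h'
      have e₁ : DirectSum.component k ℕ (AsMod k) (p : ℕ) ∘ₗ
          DirectSum.lof k ℕ (AsMod k) (p : ℕ) = LinearMap.id :=
        LinearMap.ext fun y => DirectSum.component.lof_self k _ y
      have e₂ : DirectSum.component k ℕ (QMod k) (n - 1 - (p : ℕ)) ∘ₗ
          DirectSum.lof k ℕ (QMod k) (n - 1 - (p : ℕ)) = LinearMap.id :=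
        LinearMap.ext fun y => DirectSum.component.lof_self k _ y
      rw [e₁, e₂, TensorProduct.map_id] at h'
      simpa using h'
    · intro b _ hb
      have e₁ : DirectSum.component k ℕ (AsMod k) (p : ℕ) ∘ₗ
          DirectSum.lof k ℕ (AsMod k) (b : ℕ) = 0 := by
        ext1 y
        ext1
        simp only [LinearMap.comp_apply, LinearMap.zero_apply]
        rw [DirectSum.component.of, dif_neg]
        exact fun h => hb (Fin.ext h)
      rw [← LinearMap.comp_apply (TensorProduct.map _ _), ← TensorProduct.map_comp, e₁,
        TensorProduct.map_zero_left, LinearMap.zero_apply, map_zero]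
    · exact fun h => absurd (Finset.mem_univ _) h
  · intro h
    simp [h]

theorem mem_hopfKernelComponent_iff {k : Type*} [CommRing k] {n : ℕ} {x : AsMod k n} :
    x ∈ hopfKernelComponent k n ↔
      ∀ q ≤ n, x.mapDomain (Quotient.mk (cutSetoid n q)) = 0 := by
  have h₀ : x.mapDomain descents = 0 ↔ x.mapDomain (Quotient.mk (cutSetoid n 0)) = 0 :=
    ⟨mapDomain_eq_zero_of_fibers fun σ τ h =>
        Quotient.sound ((descents_eq_iff_cutSetoid σ τ).1 h),
      mapDomain_eq_zero_of_fibers fun σ τ h =>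
        (descents_eq_iff_cutSetoid σ τ).2 (Quotient.exact h)⟩
  have h₁ : ∀ p : Fin n, cutMap k n p x = 0 ↔
      x.mapDomain (Quotient.mk (cutSetoid n (p + 1))) = 0 := fun p =>
    ⟨mapDomain_eq_zero_of_fibers fun σ τ h =>
        Quotient.sound ((stPrefix_descents_eq_iff_cutSetoid p σ τ).1 h),
      mapDomain_eq_zero_of_fibers fun σ τ h =>
        (stPrefix_descents_eq_iff_cutSetoid p σ τ).2 (Quotient.exact h)⟩
  rw [hopfKernelComponent, hopfKernel, Submodule.mem_comap, Submodule.mem_inf, LinearMap.mem_ker,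
    LinearMap.mem_ker, LinearMap.comp_apply, lTensor_coproduct_lof_eq_zero_iff, descentMap_lof,
    map_eq_zero_iff _ (show Function.Injective (DirectSum.lof k ℕ (QMod k) n) from
      DirectSum.of_injective n), h₀]
  simp only [h₁]
  constructor
  · rintro ⟨h, h'⟩ (_ | q) hq
    · exact h
    · exact h' ⟨q, hq⟩
  · exact fun h => ⟨h 0 (Nat.zero_le n), fun p => h _ p.2⟩

/-! ### Closure under partial composition -/

theorem asComp_single_left (k : Type*) [CommRing k] {n m : ℕ} (i : Fin (n + 1))
    (σ : Equiv.Perm (Fin (n + 1))) (r : k) (y : AsMod k m) :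
    asComp k i (Finsupp.single σ r) y = r • y.mapDomain (insertPerm i σ) := by
  induction y using Finsupp.induction_linear with
  | zero => simp
  | add f g hf hg => rw [map_add, hf, hg, Finsupp.mapDomain_add, smul_add]
  | single τ s => simp [asComp_single]

theorem asComp_single_right (k : Type*) [CommRing k] {n m : ℕ} (i : Fin (n + 1))
    (τ : Equiv.Perm (Fin (m + 1))) (s : k) (x : AsMod k n) :
    asComp k i x (Finsupp.single τ s) = s • x.mapDomain (insertPerm i · τ) := by
  induction x using Finsupp.induction_linear with
  | zero => simp
  | add f g hf hg => rw [map_add, LinearMap.add_apply, hf, hg, Finsupp.mapDomain_add, smul_add]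
  | single σ r => simp [asComp_single, mul_comm]

theorem proposition3p9 (k : Type*) [CommRing k] :
    (assocOperad k).IsSuboperad (hopfKernelComponent k) := by
  intro n m i x hx y hy
  rw [mem_hopfKernelComponent_iff] at hx hy ⊢
  intro q hq
  change (asComp k i x y).mapDomain (Quotient.mk (cutSetoid (n + m) q)) = 0
  have hi := i.2
  by_cases hc : q ≤ i + m
  · -- Up to the end of the block, `y` alone makes the sum vanish, for each basis element in `x`.
    have hy' := hy (q - i) (by omega)
    clear hx
    induction x using Finsupp.induction_linear with
    | zero => simp
    | add f g hf hg => rw [map_add, LinearMap.add_apply, Finsupp.mapDomain_add, hf, hg, add_zero]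
    | single σ r =>
      rw [asComp_single_left, Finsupp.mapDomain_smul, ← Finsupp.mapDomain_comp,
        mapDomain_eq_zero_of_fibers
          (g := Quotient.mk (cutSetoid (n + m) q) ∘ insertPerm i σ) (fun τ τ' h => Quotient.sound
          (cutSetoid_insertPerm_right i hc σ (Quotient.exact h))) hy', smul_zero]
  · -- Past the block the roles are exchanged.
    have hx' := hx (q - m) (by omega)
    clear hy
    induction y using Finsupp.induction_linear with
    | zero => simp
    | add f g hf hg => rw [map_add, Finsupp.mapDomain_add, hf, hg, add_zero]
    | single τ s =>
      rw [asComp_single_right, Finsupp.mapDomain_smul, ← Finsupp.mapDomain_comp,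
        mapDomain_eq_zero_of_fibers
          (g := Quotient.mk (cutSetoid (n + m) q) ∘ (insertPerm i · τ)) (fun σ σ' h => Quotient.sound
          (cutSetoid_insertPerm_left i (not_le.1 hc) τ (Quotient.exact h))) hx', smul_zero]
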